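/- Let $\mathcal S,\mathcal A$ be finite nonempty sets, $H$ a horizon, $\varepsilon\ge 0$, and let $\phi:\mathcal S\times\mathcal A\to\mathbb R^d$ be a feature map with $\|\phi(s,a)\|\le 1$ whose values span $\mathbb R^d$. Fix a measure $\nu$ on $\mathbb R$ concentrated on $[0,1]$. An episodic linear MDP $\mathcal M$ consists, for each step $h\in[H]$ and each pair $(s,a)$, of a transition law $p_{\mathcal M,h}(s,a,\cdot)$ on $\mathcal S$ and a reward law $q_{\mathcal M,h}(s,a,\cdot)\ll\nu$ with mean $r_{\mathcal M,h}(s,a)$ such that $p_{\mathcal M,h}(s,a,s')=\phi(s,a)^\top\mu_{\mathcal M,h}(s')$ and $r_{\mathcal M,h}(s,a)=\phi(s,a)^\top\theta_{\mathcal M,h}$, where $\theta_{\mathcal M,h},\mu_{\mathcal M,h}(s')\in\mathbb R^d$ satisfy $\|\theta_{\mathcal M,h}\|\le\sqrt d$ and $\|\sum_{s}|\mu_{\mathcal M,h}(s)|\|\le\sqrt d$ (entrywise absolute values, Euclidean norms). Let $\mathbb M$ be the set of these MDPs. A policy $\pi$ maps, in each step, states to actions. Put $V^\pi_{\mathcal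 M,h}(s)=\mathbb E_{\mathcal M}[\sum_{k=h}^H r_{\mathcal M,k}(s^\pi_k,\pi_k(s^\pi_k))\mid s^\pi_h=s]$, $V^\star_{\mathcal M,h}=\max_\pi V^\pi_{\mathcal M,h}$ (with $V^\star_{\mathcal M,H+1}=0$) and $Q^\star_{\mathcal M,h}(s,a)=r_{\mathcal M,h}(s,a)+\sum_{s'}p_{\mathcal M,h}(s,a,s')V^\star_{\mathcal M,h+1}(s')$. Let $\Pi^\star_\varepsilon(\mathcal M)$ be the set of policies $\pi$ with $V^\pi_{\mathcal M,1}\ge V^\star_{\mathcal M,1}-\varepsilon$ pointwise. Let $\mathcal M\in\mathbb M$ have a unique policy $\pi^\star_{\mathcal M}$ that is optimal at every step, i.e. $V^{\pi^\star_{\mathcal M}}_{\mathcal M,h}=V^\star_{\mathcal M,h}$ for all $h\in[H]$ (this is the case in particular if exactly one policy maximizes $V^\pi_{\mathcal M,1}$ pointwise), and let $$\Delta(\mathcal M)=\min_{h,s,\,a\ne\pi^\star_{\mathcal M,h}(s)}\big(V^\star_{\mathcal M,h}(s)-Q^\star_{\mathcal M,h}(s,a)\big),\qquad \min\emptyset=+\infty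 .$$ Write $\mathcal M\ll\mathcal M'$ if $p_{\mathcal M,h}(s,a,\cdot)\ll p_{\mathcal M',h}(s,a,\cdot)$ and $q_{\mathcal M,h}(s,a,\cdot)\ll q_{\mathcal M',h}(s,a,\cdot)$ for all $h,s,a$; put $\mathrm{KL}_{\mathcal M|\mathcal M'}(h,s,a)=\mathrm{KL}(q_{\mathcal M,h}(s,a,\cdot)\|q_{\mathcal M',h}(s,a,\cdot))+\mathrm{KL}(p_{\mathcal M,h}(s,a,\cdot)\|p_{\mathcal M',h}(s,a,\cdot))$ and $\mathrm{Alt}_\varepsilon(\mathcal M)=\{\mathcal M'\in\mathbb M:\mathcal M\ll\mathcal M',\ \Pi^\star_\varepsilon(\mathcal M)\cap\Pi^\star_\varepsilon(\mathcal M')=\emptyset\}$. Let $\Sigma$ be the set of probability vectors on $\mathcal S\times\mathcal A$. For $\omega=(\omega_h)_{h\in[H]}\in\Sigma^H$ define, with values in $[0,\infty]$ and the conventions $\inf\emptyset=\infty$, $1/0=\infty$, $1/\infty=0$ and $0\cdot\infty=0$, $$T(\mathcal M,\omega)^{-1}=\inf_{\mathcal M'\in\mathrm{Alt}_\varepsilon(\mathcal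 M)}\sum_{h,s,a}\omega_{h,s,a}\,\mathrm{KL}_{\mathcal M|\mathcal M'}(h,s,a),\qquad T^\star(\mathcal M)^{-1}=\sup_{\omega\in\Sigma^H}T(\mathcal M,\omega)^{-1}.$$ For $w\in\Sigma$ let $\Lambda(w)=\sum_{s,a}w_{s,a}\phi(s,a)\phi(s,a)^\top$ and $\sigma(w)=\max_{s,a}\phi(s,a)^\top\Lambda(w)^{-1}\phi(s,a)$, with $\sigma(w)=+\infty$ if $\Lambda(w)$ is singular. Theorem. For all $\omega\in\Sigma^H$, $$T(\mathcal M,\omega)\le\frac{10H^2\sum_{h=1}^H\sigma(\omega_h)}{3(\Delta(\mathcal M)+\varepsilon)^2},\qquad\text{and}\qquad T^\star(\mathcal M)\le\frac{10H^3d}{3(\Delta(\mathcal M)+\varepsilon)^2},$$ where the right-hand sides are read as $0$ if $\Delta(\mathcal M)=+\infty$. -/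

import Mathlib

open MeasureTheory InformationTheory
open scoped ENNReal BigOperators

noncomputable section

namespace LinMDP

/-- An episodic linear MDP with horizon `H`, finite state space `S`, finite action space `A`, feature
map `φ` and reward distributions dominated by `ν`. The steps `1, …, H` are indexed by `Fin H`
(so `h : Fin H` is step `h + 1`). -/
structure EpisodicLinearMDP {S A : Type*} [Fintype S] [Fintype A] {d : ℕ} (H : ℕ)
    (φ : S → A → EuclideanSpace ℝ (Fin d)) (ν : Measure ℝ) where
  /-- `p h s a` is the law of the next state. -/
  p : Fin H → S → A → PMF S
  /-- `q h s a` is the law of the reward. -/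
  q : Fin H → S → A → Measure ℝ
  q_prob : ∀ h s a, IsProbabilityMeasure (q h s a)
  q_ac : ∀ h s a, q h s a ≪ ν
  /-- `d` (signed) measures on `S`: the mass of the `i`-th one at `s'` is `μ h s' i`. -/
  μ : Fin H → S → EuclideanSpace ℝ (Fin d)
  θ : Fin H → EuclideanSpace ℝ (Fin d)
  p_linear : ∀ h s a s', (p h s a s').toReal = inner ℝ (φ s a) (μ h s')
  r_linear : ∀ h s a, ∫ x, x ∂(q h s a) = inner ℝ (φ s a) (θ h)
  θ_bound : ∀ h, ‖θ h‖ ≤ √(d : ℝ)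
  μ_bound : ∀ h, ‖(WithLp.toLp 2 (fun i => ∑ s, |μ h s i|) : EuclideanSpace ℝ (Fin d))‖ ≤ √(d : ℝ)

/-- A control policy maps, in each step, states to actions. -/
abbrev Policy (S A : Type*) (H : ℕ) := Fin H → S → A

namespace EpisodicLinearMDP

variable {S A : Type*} [Fintype S] [Fintype A] {d H : ℕ}
  {φ : S → A → EuclideanSpace ℝ (Fin d)} {ν : Measure ℝ}

/-- Mean reward. -/
def r (M : EpisodicLinearMDP H φ ν) (h : Fin H) (s : S) (a : A) : ℝ := ∫ x, x ∂(M.q h s a)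

/-- The law, under policy `π`, of the state `n` steps after step `h`, given that the state at
step `h` is `s`. (The process is frozen after the last transition.) -/
def stateLaw (M : EpisodicLinearMDP H φ ν) (π : Policy S A H) (h : ℕ) (s : S) : ℕ → PMF S
  | 0 => PMF.pure s
  | n + 1 => (stateLaw M π h s n).bind fun s' =>
      if hk : h + n < H then M.p ⟨h + n, hk⟩ s' (π ⟨h + n, hk⟩ s') else PMF.pure s'

/-- State value function: the expected total reward collected from step `h` to the last step,
given that the state at step `h` is `s`. It is `0` for `h = H`, i.e. after the last step. -/
def V (M : EpisodicLinearMDP H φ ν) (π : Policy S A H) (h : ℕ) (s : S) : ℝ :=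
  ∑ k : Fin H, if h ≤ (k : ℕ) then
    ∑ s', (M.stateLaw π h s ((k : ℕ) - h) s').toReal * M.r k s' (π k s') else 0

/-- Optimal state value function. -/
def Vstar (M : EpisodicLinearMDP H φ ν) (h : ℕ) (s : S) : ℝ := ⨆ π : Policy S A H, M.V π h s

/-- Optimal (state, action) value function. -/
def Qstar (M : EpisodicLinearMDP H φ ν) (h : Fin H) (s : S) (a : A) : ℝ :=
  M.r h s a + ∑ s', (M.p h s a s').toReal * M.Vstar ((h : ℕ) + 1) s'

/-- `π` maximizes the value function pointwise, at every step. -/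
def IsOptimal (M : EpisodicLinearMDP H φ ν) (π : Policy S A H) : Prop :=
  ∀ (h : Fin H) (π' : Policy S A H) (s : S), M.V π' h s ≤ M.V π h s

/-- The set of `ε`-optimal policies, with regard to the value function at the first step. -/
def epsOptimal (M : EpisodicLinearMDP H φ ν) (ε : ℝ) : Set (Policy S A H) :=
  {π | ∀ s, M.Vstar 0 s - ε ≤ M.V π 0 s}

/-- Sub-optimality gap, where `πstar` is the optimal policy; by convention it is infinite when there
is no sub-optimal triple `(h, s, a)`. -/
def gap (M : EpisodicLinearMDP H φ ν) (πstar : Policy S A H) : ℝ≥0∞ :=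
  ⨅ (h : Fin H) (s : S) (a : A) (_ : a ≠ πstar h s), ENNReal.ofReal (M.Vstar h s - M.Qstar h s a)

variable [MeasurableSpace S]

/-- Absolute continuity of transitions and rewards, `M ≪ M'`. -/
def AbsCont (M M' : EpisodicLinearMDP H φ ν) : Prop :=
  ∀ h s a, (M.p h s a).toMeasure ≪ (M'.p h s a).toMeasure ∧ M.q h s a ≪ M'.q h s a

/-- Kullback-Leibler divergence at `(h, s, a)`: reward part plus transition part. -/
def KL (M M' : EpisodicLinearMDP H φ ν) (h : Fin H) (s : S) (a : A) : ℝ≥0∞ :=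
  klDiv (M.q h s a) (M'.q h s a) + klDiv (M.p h s a).toMeasure (M'.p h s a).toMeasure

/-- The set of alternative MDPs. -/
def Alt (M : EpisodicLinearMDP H φ ν) (ε : ℝ) : Set (EpisodicLinearMDP H φ ν) :=
  {M' | M.AbsCont M' ∧ M.epsOptimal ε ∩ M'.epsOptimal ε = ∅}

/-- `T(M, ω)`, with values in `[0, ∞]`. -/
def T (M : EpisodicLinearMDP H φ ν) (ε : ℝ) (ω : Fin H → stdSimplex ℝ (S × A)) : ℝ≥0∞ :=
  (⨅ M' ∈ M.Alt ε, ∑ h, ∑ s, ∑ a, ENNReal.ofReal ((ω h : S × A → ℝ) (s, a)) * M.KL M' h s a)⁻¹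

/-- `T*(M)`, with values in `[0, ∞]`. -/
def Tstar (M : EpisodicLinearMDP H φ ν) (ε : ℝ) : ℝ≥0∞ :=
  (⨆ ω : Fin H → stdSimplex ℝ (S × A), (M.T ε ω)⁻¹)⁻¹

end EpisodicLinearMDP

/-- The feature matrix `Λ(ω)`. -/
def featureMatrix {S A : Type*} [Fintype S] [Fintype A] {d : ℕ}
    (φ : S → A → EuclideanSpace ℝ (Fin d)) (ω : stdSimplex ℝ (S × A)) :
    Matrix (Fin d) (Fin d) ℝ :=
  ∑ s, ∑ a, (ω : S × A → ℝ) (s, a) • Matrix.vecMulVec (φ s a).ofLp (φ s a).ofLp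

open Classical in
/-- `σ(ω) = max φᵀ Λ(ω)⁻¹ φ`, which is infinite when `Λ(ω)` is singular. -/
def sigma {S A : Type*} [Fintype S] [Fintype A] {d : ℕ}
    (φ : S → A → EuclideanSpace ℝ (Fin d)) (ω : stdSimplex ℝ (S × A)) : ℝ≥0∞ :=
  if IsUnit (featureMatrix φ ω).det then
    ⨆ (s : S) (a : A), ENNReal.ofReal
      ((φ s a).ofLp ⬝ᵥ ((featureMatrix φ ω)⁻¹).mulVec (φ s a).ofLp)
  else ⊤

end LinMDP

end

/-! Fix an alternative `M'`. The optimal policy `πstar` of `M` is not `ε`-optimal in `M'`, so some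
policy `π` beats it there by more than `ε`. The first-step advantage can be traced to a state and
step where the two policies choose different actions (`exists_ne_of_lt_V_sub`). There, `π` loses at
least the gap in `M` and gains more than `ε` in `M'`, so changing the model shifts the values of the
two policies by at least gap plus `ε` in total (`exists_separation_of_mem_Alt`).

Such a shift costs information. By the simulation lemma `abs_V_sub_le`, it is at most a sum over
steps of one-step Bellman errors. Each error is linear in the feature, so `sq_inner_le_sigma` bounds
its square everywhere by `σ` times its mean square under the design. Pinsker's inequality bounds
that mean square by `H ^ 2 / 2` times the weighted divergence. Cauchy–Schwarz over the steps gives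
`sq_gap_add_le`, hence `T_le`.

The bound on `Tstar` uses at every step the same design with `σ ≤ d`, which exists by
Kiefer–Wolfowitz (`exists_sigma_le`). -/

noncomputable section

namespace LinMDP

/-! ### Pinsker's inequality for bounded functions. -/

section Pinsker

variable {α : Type*} [MeasurableSpace α] {μ ν : Measure α} [IsProbabilityMeasure μ]
  [IsProbabilityMeasure ν] {f : α → ℝ} {b : ℝ}

/-- Donsker–Varadhan inequality combined with Hoeffding's lemma. -/
theorem mul_integral_sub_le_klDiv (hf : AEMeasurable f ν) (hb : ∀ᵐ x ∂ν, f x ∈ Set.Icc 0 b)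
    (hkl : klDiv μ ν ≠ ∞) (t : ℝ) :
    t * (∫ x, f x ∂μ - ∫ x, f x ∂ν) ≤ (klDiv μ ν).toReal + b ^ 2 * t ^ 2 / 8 := by
  obtain ⟨hac, hint⟩ := klDiv_ne_top_iff.1 hkl
  set m := ∫ x, f x ∂ν with hm
  have hsub := ProbabilityTheory.hasSubgaussianMGF_of_mem_Icc hf hb
  have hexp : Integrable (fun x => Real.exp (t * (f x - m))) ν := hsub.integrable_exp_mul t
  have hmgf : ∫ x, Real.exp (t * (f x - m)) ∂ν ≤ Real.exp (b ^ 2 * t ^ 2 / 8) := by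
    have h := hsub.mgf_le t
    rw [ProbabilityTheory.mgf] at h
    refine h.trans_eq ?_
    congr 1
    simp only [sub_zero, NNReal.coe_pow, NNReal.coe_div, coe_nnnorm, NNReal.coe_ofNat,
      Real.norm_eq_abs, div_pow, sq_abs]
    ring
  have hfμ : Integrable f μ :=
    Integrable.of_mem_Icc 0 b (hf.mono_ac hac) (hac.ae_le hb)
  have hfμ' : Integrable (fun x => t * (f x - m)) μ :=
    (hfμ.sub (integrable_const m)).const_mul t
  have hprob := isProbabilityMeasure_tilted hexp
  have hac' : μ ≪ ν.tilted (fun x => t * (f x - m)) := hac.trans (absolutelyContinuous_tilted hexp)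
  -- The Donsker–Varadhan step: the divergence of `μ` from the exponentially tilted `ν` is
  -- nonnegative.
  have hpos := integral_llr_add_sub_measure_univ_nonneg hac'
    (integrable_llr_tilted_right hac hfμ' hint hexp)
  rw [integral_llr_tilted_right hac hfμ' hexp hint] at hpos
  have hkl' := toReal_klDiv_of_measure_eq hac (by simp)
  have hval : ∫ x, t * (f x - m) ∂μ = t * (∫ x, f x ∂μ - m) := by
    rw [integral_const_mul, integral_sub hfμ (integrable_const m)]
    simp
  have hlog := (Real.log_le_iff_le_exp (integral_exp_pos hexp)).2 hmgf
  simp only [probReal_univ] at hpos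
  rw [hval] at hpos
  rw [hkl']
  linarith

/-- Pinsker's inequality, for expectations of bounded functions. -/
theorem abs_integral_sub_le_klDiv (hf : AEMeasurable f ν) (hb : ∀ᵐ x ∂ν, f x ∈ Set.Icc 0 b)
    (hb0 : 0 ≤ b) (hkl : klDiv μ ν ≠ ∞) :
    |∫ x, f x ∂ν - ∫ x, f x ∂μ| ≤ b * √((klDiv μ ν).toReal / 2) := by
  obtain ⟨hac, hint⟩ := klDiv_ne_top_iff.1 hkl
  rcases hb0.eq_or_lt with rfl | hbpos
  · have h0 : f =ᵐ[ν] 0 := by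
      filter_upwards [hb] with x hx
      exact le_antisymm hx.2 hx.1
    rw [integral_eq_zero_of_ae h0, integral_eq_zero_of_ae (hac.ae_le h0)]
    simp
  · refine abs_le_of_sq_le_sq ?_ (by positivity)
    -- This `t` maximizes the quadratic `t * D - b ^ 2 * t ^ 2 / 8`, where `D` is the difference of
    -- the means.
    have h := mul_integral_sub_le_klDiv hf hb hkl (4 * (∫ x, f x ∂μ - ∫ x, f x ∂ν) / b ^ 2)
    rw [mul_pow, Real.sq_sqrt (by positivity)]
    set D := ∫ x, f x ∂μ - ∫ x, f x ∂ν with hD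
    have e1 : 4 * D / b ^ 2 * D = 4 * (D ^ 2 / b ^ 2) := by ring
    have e2 : b ^ 2 * (4 * D / b ^ 2) ^ 2 / 8 = 2 * (D ^ 2 / b ^ 2) := by field_simp; ring
    rw [e1, e2] at h
    have h2 : D ^ 2 / b ^ 2 ≤ (klDiv μ ν).toReal / 2 := by linarith
    rw [div_le_iff₀ (by positivity)] at h2
    calc _ = D ^ 2 := by rw [hD]; ring
      _ ≤ _ := by linarith

end Pinsker

end LinMDP
end

/-! ### Value functions: Bellman recursion and change of model. -/

noncomputable section

namespace LinMDP

theorem _root_.PMF.toReal_bind_apply {α β : Type*} [Fintype α] (p : PMF α) (f : α → PMF β) (y : β) :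
    (p.bind f y).toReal = ∑ x, (p x).toReal * (f x y).toReal := by
  rw [PMF.bind_apply, tsum_fintype, ENNReal.toReal_sum]
  · simp
  · exact fun x _ => ENNReal.mul_ne_top (p.apply_ne_top x) ((f x).apply_ne_top y)

theorem _root_.PMF.sum_toReal {α : Type*} [Fintype α] (p : PMF α) : ∑ x, (p x).toReal = 1 := by
  rw [← ENNReal.toReal_sum fun x _ => p.apply_ne_top x, ← tsum_fintype (L := .unconditional _),
    p.tsum_coe, ENNReal.toReal_one]

namespace EpisodicLinearMDP

variable {S A : Type*} [Fintype S] [Fintype A] {d H : ℕ}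
  {φ : S → A → EuclideanSpace ℝ (Fin d)} {ν : Measure ℝ}

theorem ae_q_mem_Icc (hν : ν (Set.Icc 0 1)ᶜ = 0) (M : EpisodicLinearMDP H φ ν) (h : Fin H) (s : S)
    (a : A) : ∀ᵐ x ∂(M.q h s a), x ∈ Set.Icc (0 : ℝ) 1 :=
  (M.q_ac h s a).ae_le (mem_ae_iff.2 hν)

theorem r_mem_Icc (hν : ν (Set.Icc 0 1)ᶜ = 0) (M : EpisodicLinearMDP H φ ν) (h : Fin H) (s : S)
    (a : A) : M.r h s a ∈ Set.Icc (0 : ℝ) 1 := by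
  have := M.q_prob h s a
  have hae := M.ae_q_mem_Icc hν h s a
  refine ⟨integral_nonneg_of_ae (hae.mono fun x hx => hx.1), ?_⟩
  have h1 : ∫ x, x ∂(M.q h s a) ≤ ∫ _, (1 : ℝ) ∂(M.q h s a) :=
    integral_mono_ae (Integrable.of_mem_Icc 0 1 aemeasurable_id hae) (integrable_const _)
      (hae.mono fun x hx => hx.2)
  simpa [r] using h1

/-- `stateLaw` appends transitions at the end of the trajectory, while Bellman's equation splits off
the first one; associativity of `bind` reconciles the two. -/
theorem stateLaw_succ_left (M : EpisodicLinearMDP H φ ν) (π : Policy S A H) {h : ℕ} (hh : h < H)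
    (s : S) (n : ℕ) :
    M.stateLaw π h s (n + 1) =
      (M.p ⟨h, hh⟩ s (π ⟨h, hh⟩ s)).bind fun s' => M.stateLaw π (h + 1) s' n := by
  induction n with
  | zero => simp [stateLaw, hh, PMF.pure_bind, PMF.bind_pure]
  | succ n ih =>
    rw [stateLaw, ih, PMF.bind_bind]
    have e : h + (n + 1) = h + 1 + n := by ring
    simp only [e]
    rfl

/-- Bellman's equation for the value function of a policy. -/
theorem V_eq (M : EpisodicLinearMDP H φ ν) (π : Policy S A H) {h : ℕ} (hh : h < H) (s : S) :
    M.V π h s = M.r ⟨h, hh⟩ s (π ⟨h, hh⟩ s) +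
      ∑ s', (M.p ⟨h, hh⟩ s (π ⟨h, hh⟩ s) s').toReal * M.V π (h + 1) s' := by
  classical
  have hr : M.r ⟨h, hh⟩ s (π ⟨h, hh⟩ s) =
      ∑ k : Fin H, if k = ⟨h, hh⟩ then M.r ⟨h, hh⟩ s (π ⟨h, hh⟩ s) else 0 := by simp
  rw [hr]
  simp only [V, Finset.mul_sum]
  rw [Finset.sum_comm (s := Finset.univ (α := S)), ← Finset.sum_add_distrib]
  refine Finset.sum_congr rfl fun k _ => ?_
  rcases lt_trichotomy (k : ℕ) h with hk | hk | hk
  · have hne : k ≠ ⟨h, hh⟩ := fun e => by simp [e] at hk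
    simp [hne, hk.not_ge, show ¬ h + 1 ≤ (k : ℕ) by omega]
  · obtain rfl : k = ⟨h, hh⟩ := Fin.ext hk
    simp only [le_refl, if_true, Nat.sub_self, stateLaw, PMF.pure_apply]
    rw [Finset.sum_eq_single s (fun b _ hb => by simp [hb]) (by simp)]
    simp
  · have hne : k ≠ ⟨h, hh⟩ := fun e => by simp [e] at hk
    have e : (k : ℕ) - h = (k - (h + 1)) + 1 := by omega
    simp only [hk.le, Nat.succ_le_of_lt hk, if_true, hne, if_false, zero_add]
    rw [e]
    simp only [M.stateLaw_succ_left π hh, PMF.toReal_bind_apply, Finset.sum_mul, Finset.mul_sum]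
    rw [Finset.sum_comm]
    exact Finset.sum_congr rfl fun _ _ => Finset.sum_congr rfl fun _ _ => mul_assoc _ _ _

theorem V_of_le (M : EpisodicLinearMDP H φ ν) (π : Policy S A H) {h : ℕ} (hh : H ≤ h) (s : S) :
    M.V π h s = 0 :=
  Finset.sum_eq_zero fun k _ => if_neg (k.2.trans_le hh).not_ge

theorem V_mem_Icc (hν : ν (Set.Icc 0 1)ᶜ = 0) (M : EpisodicLinearMDP H φ ν) (π : Policy S A H)
    {h n : ℕ} (hn : h + n = H) (s : S) : M.V π h s ∈ Set.Icc (0 : ℝ) n := by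
  induction n generalizing h s with
  | zero => simp [M.V_of_le π (show H ≤ h by omega)]
  | succ n ih =>
    have hh : h < H := by omega
    have ih' := fun s' => ih (h := h + 1) (by omega) s'
    have hr := M.r_mem_Icc hν ⟨h, hh⟩ s (π ⟨h, hh⟩ s)
    rw [M.V_eq π hh]
    set p := M.p ⟨h, hh⟩ s (π ⟨h, hh⟩ s)
    refine ⟨add_nonneg hr.1 (Finset.sum_nonneg fun s' _ =>
      mul_nonneg ENNReal.toReal_nonneg (ih' s').1), ?_⟩
    have hle : ∑ s', (p s').toReal * M.V π (h + 1) s' ≤ ∑ s', (p s').toReal * n :=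
      Finset.sum_le_sum fun s' _ => mul_le_mul_of_nonneg_left (ih' s').2 ENNReal.toReal_nonneg
    rw [← Finset.sum_mul, p.sum_toReal] at hle
    push_cast
    linarith [hr.2]

theorem V_le_Vstar (M : EpisodicLinearMDP H φ ν) (π : Policy S A H) (h : ℕ) (s : S) :
    M.V π h s ≤ M.Vstar h s :=
  le_ciSup (f := fun π : Policy S A H => M.V π h s) (Set.finite_range _).bddAbove π

theorem IsOptimal.Vstar_eq {M : EpisodicLinearMDP H φ ν} {πstar : Policy S A H}
    (hopt : M.IsOptimal πstar) {h : ℕ} (s : S) : M.Vstar h s = M.V πstar h s := by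
  have : Nonempty (Policy S A H) := ⟨πstar⟩
  refine le_antisymm (ciSup_le fun π => ?_) (M.V_le_Vstar πstar h s)
  by_cases hh : h < H
  · exact hopt ⟨h, hh⟩ π s
  · rw [M.V_of_le π (by omega), M.V_of_le πstar (by omega)]

theorem V_le_Qstar (M : EpisodicLinearMDP H φ ν) (π : Policy S A H) (h : Fin H) (s : S) :
    M.V π h s ≤ M.Qstar h s (π h s) := by
  rw [M.V_eq π h.2]
  exact add_le_add le_rfl (Finset.sum_le_sum fun s' _ =>
    mul_le_mul_of_nonneg_left (M.V_le_Vstar π _ s') ENNReal.toReal_nonneg)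

/-- A policy that improves on another one by more than `ε` does so at a state and step where the two
act differently. -/
theorem exists_ne_of_lt_V_sub (M : EpisodicLinearMDP H φ ν) (π π' : Policy S A H) {ε : ℝ}
    (hε : 0 ≤ ε) {h : ℕ} {s : S} (hlt : ε < M.V π' h s - M.V π h s) :
    ∃ (k : Fin H) (s' : S), π' k s' ≠ π k s' ∧ ε < M.V π' k s' - M.V π k s' := by
  by_contra! hcon
  -- Backward induction: where the actions agree, rewards and transitions cancel, and the advantage
  -- is an average of the advantages one step later.
  suffices hle : ∀ n h s, h + n = H → M.V π' h s - M.V π h s ≤ ε by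
    by_cases hh : h < H
    · exact hlt.not_ge (hle (H - h) h s (by omega))
    · rw [M.V_of_le π (by omega), M.V_of_le π' (by omega)] at hlt
      linarith
  intro n
  induction n with
  | zero =>
    intro h s hn
    rw [M.V_of_le π (by omega), M.V_of_le π' (by omega)]
    simpa using hε
  | succ n ih =>
    intro h s hn
    have hh : h < H := by omega
    by_cases heq : π' ⟨h, hh⟩ s = π ⟨h, hh⟩ s
    · rw [M.V_eq π hh, M.V_eq π' hh, heq, add_sub_add_left_eq_sub, ← Finset.sum_sub_distrib]
      set p := M.p ⟨h, hh⟩ s (π ⟨h, hh⟩ s)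
      calc _ ≤ ∑ s', (p s').toReal * ε := Finset.sum_le_sum fun s' _ => by
            rw [← mul_sub]
            exact mul_le_mul_of_nonneg_left (ih (h + 1) s' (by omega)) ENNReal.toReal_nonneg
        _ = ε := by rw [← Finset.sum_mul, p.sum_toReal, one_mul]
    · exact hcon ⟨h, hh⟩ s heq

/-- Simulation lemma. -/
theorem abs_V_sub_le (M M' : EpisodicLinearMDP H φ ν) (π : Policy S A H) {g : ℕ → ℝ}
    (hg : ∀ (k : Fin H) s a, |M'.r k s a - M.r k s a +
      ∑ s', ((M'.p k s a s').toReal - (M.p k s a s').toReal) * M'.V π (k + 1) s'| ≤ g k)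
    {h n : ℕ} (hn : h + n = H) (s : S) :
    |M'.V π h s - M.V π h s| ≤ ∑ k ∈ Finset.Ico h H, g k := by
  induction n generalizing h s with
  | zero =>
    rw [V_of_le _ π (by omega), V_of_le _ π (by omega)]
    simp [show h = H by omega]
  | succ n ih =>
    have hh : h < H := by omega
    rw [Finset.sum_eq_sum_Ico_succ_bot hh, V_eq _ π hh, V_eq _ π hh]
    set a := π ⟨h, hh⟩ s
    set p := M.p ⟨h, hh⟩ s a
    -- The Bellman error is evaluated on the values of `M'`; the remaining difference of values is
    -- averaged under the transitions of `M`.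
    have hsplit : M'.r ⟨h, hh⟩ s a + ∑ s', (M'.p ⟨h, hh⟩ s a s').toReal * M'.V π (h + 1) s' -
        (M.r ⟨h, hh⟩ s a + ∑ s', (p s').toReal * M.V π (h + 1) s') =
        (M'.r ⟨h, hh⟩ s a - M.r ⟨h, hh⟩ s a +
          ∑ s', ((M'.p ⟨h, hh⟩ s a s').toReal - (p s').toReal) * M'.V π (h + 1) s') +
        ∑ s', (p s').toReal * (M'.V π (h + 1) s' - M.V π (h + 1) s') := by
      simp only [sub_mul, mul_sub, Finset.sum_sub_distrib]
      ring
    rw [hsplit]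
    refine (abs_add_le _ _).trans (add_le_add (hg ⟨h, hh⟩ s a) ?_)
    calc _ ≤ ∑ s', |(p s').toReal * (M'.V π (h + 1) s' - M.V π (h + 1) s')| :=
          Finset.abs_sum_le_sum_abs _ _
      _ ≤ ∑ s', (p s').toReal * ∑ k ∈ Finset.Ico (h + 1) H, g k :=
          Finset.sum_le_sum fun s' _ => by
            rw [abs_mul, abs_of_nonneg ENNReal.toReal_nonneg]
            exact mul_le_mul_of_nonneg_left (ih (by omega) s') ENNReal.toReal_nonneg
      _ = _ := by rw [← Finset.sum_mul, p.sum_toReal, one_mul]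

end EpisodicLinearMDP
end LinMDP
end

/-! ### Feature matrices and optimal designs. -/

noncomputable section

namespace LinMDP

section Features

variable {S A : Type*} [Fintype S] [Fintype A] {d : ℕ} (φ : S → A → EuclideanSpace ℝ (Fin d))

theorem dotProduct_featureMatrix_mulVec (ω : stdSimplex ℝ (S × A)) (u v : Fin d → ℝ) :
    u ⬝ᵥ (featureMatrix φ ω).mulVec v =
      ∑ s, ∑ a, (ω : S × A → ℝ) (s, a) * (((φ s a).ofLp ⬝ᵥ u) * ((φ s a).ofLp ⬝ᵥ v)) := by
  simp only [featureMatrix, Matrix.sum_mulVec, dotProduct_sum, Matrix.smul_mulVec,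
    dotProduct_smul, Matrix.vecMulVec_mulVec, smul_eq_mul]
  refine Finset.sum_congr rfl fun s _ => Finset.sum_congr rfl fun a _ => ?_
  simp [dotProduct_comm u]

theorem isHermitian_featureMatrix (ω : stdSimplex ℝ (S × A)) :
    (featureMatrix φ ω).IsHermitian := by
  ext i j
  simp [featureMatrix, Matrix.sum_apply, Matrix.vecMulVec_apply, mul_comm]

theorem det_featureMatrix_nonneg (ω : stdSimplex ℝ (S × A)) : 0 ≤ (featureMatrix φ ω).det := by
  refine (Matrix.PosSemidef.of_dotProduct_mulVec_nonneg (isHermitian_featureMatrix φ ω)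
    fun x => ?_).det_nonneg
  rw [star_trivial, dotProduct_featureMatrix_mulVec]
  exact Finset.sum_nonneg fun s _ => Finset.sum_nonneg fun a _ =>
    mul_nonneg (ω.2.1 _) (mul_self_nonneg _)

theorem ofReal_le_sigma (ω : stdSimplex ℝ (S × A)) (s : S) (a : A) :
    ENNReal.ofReal ((φ s a).ofLp ⬝ᵥ ((featureMatrix φ ω)⁻¹).mulVec (φ s a).ofLp) ≤ sigma φ ω := by
  unfold sigma
  split_ifs
  · exact le_iSup₂ (f := fun s a => ENNReal.ofReal
      ((φ s a).ofLp ⬝ᵥ ((featureMatrix φ ω)⁻¹).mulVec (φ s a).ofLp)) s a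
  · exact le_top

/-- Cauchy–Schwarz inequality for the norms associated with `Λ(ω)` and its inverse. -/
theorem sq_inner_le_sigma (ω : stdSimplex ℝ (S × A)) (hσ : sigma φ ω ≠ ∞) (s : S) (a : A)
    (y : EuclideanSpace ℝ (Fin d)) :
    inner ℝ (φ s a) y ^ 2 ≤ (sigma φ ω).toReal *
      ∑ s', ∑ a', (ω : S × A → ℝ) (s', a') * inner ℝ (φ s' a') y ^ 2 := by
  have hdet : IsUnit (featureMatrix φ ω).det := by
    by_contra hdet
    exact hσ (if_neg hdet)
  have hin : ∀ s a, inner ℝ (φ s a) y = (φ s a).ofLp ⬝ᵥ y.ofLp := fun s a => by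
    rw [EuclideanSpace.inner_eq_star_dotProduct, star_trivial, dotProduct_comm]
  set Λ := featureMatrix φ ω with hΛ
  -- With `u = Λ⁻¹ φ`, the pairing of `φ` with `y` is the `Λ`-form of `y` and `u`, and the
  -- `Λ`-square of `u` is `φᵀ Λ⁻¹ φ`, which `σ` dominates.
  set u := (Λ⁻¹).mulVec (φ s a).ofLp with hu
  have hΛu : Λ.mulVec u = (φ s a).ofLp := by
    rw [hu, Matrix.mulVec_mulVec, Matrix.mul_nonsing_inv _ hdet, Matrix.one_mulVec]
  have huu : u ⬝ᵥ Λ.mulVec u ≤ (sigma φ ω).toReal := by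
    rw [hΛu, dotProduct_comm]
    exact (ENNReal.ofReal_le_iff_le_toReal hσ).1 (ofReal_le_sigma φ ω s a)
  have hy : (φ s a).ofLp ⬝ᵥ y.ofLp = y.ofLp ⬝ᵥ Λ.mulVec u := by rw [hΛu, dotProduct_comm]
  simp only [hin]
  rw [hy]
  rw [hΛ, dotProduct_featureMatrix_mulVec] at huu ⊢
  simp only [← Fintype.sum_prod_type' (f := fun s' a' => (ω : S × A → ℝ) (s', a') *
    ((φ s' a').ofLp ⬝ᵥ y.ofLp) ^ 2), ← Fintype.sum_prod_type' (f := fun s' a' =>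
    (ω : S × A → ℝ) (s', a') * (((φ s' a').ofLp ⬝ᵥ y.ofLp) * ((φ s' a').ofLp ⬝ᵥ u)))]
  rw [← Fintype.sum_prod_type' (f := fun s' a' =>
    (ω : S × A → ℝ) (s', a') * (((φ s' a').ofLp ⬝ᵥ u) * ((φ s' a').ofLp ⬝ᵥ u)))] at huu
  have hω : ∀ x, 0 ≤ (ω : S × A → ℝ) x := ω.2.1
  refine (Finset.sum_sq_le_sum_mul_sum_of_sq_le_mul Finset.univ
    (f := fun x : S × A => (ω : S × A → ℝ) x * (((φ x.1 x.2).ofLp ⬝ᵥ u) * ((φ x.1 x.2).ofLp ⬝ᵥ u)))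
    (g := fun x : S × A => (ω : S × A → ℝ) x * ((φ x.1 x.2).ofLp ⬝ᵥ y.ofLp) ^ 2)
    (fun x _ => mul_nonneg (hω x) (mul_self_nonneg _))
    (fun x _ => mul_nonneg (hω x) (sq_nonneg _)) (fun x _ => le_of_eq (by ring))).trans ?_
  exact mul_le_mul_of_nonneg_right huu
    (Finset.sum_nonneg fun x _ => mul_nonneg (hω x) (sq_nonneg _))

/-- Uniform weights work: a kernel vector would be orthogonal to every feature, hence to the whole
space. -/
theorem exists_det_featureMatrix_pos [Nonempty S] [Nonempty A]
    (hφ_span : Submodule.span ℝ (Set.range fun x : S × A => φ x.1 x.2) = ⊤) :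
    ∃ ω : stdSimplex ℝ (S × A), 0 < (featureMatrix φ ω).det := by
  have hc : (0 : ℝ) < Fintype.card (S × A) := by exact_mod_cast Fintype.card_pos
  let ω : stdSimplex ℝ (S × A) := ⟨fun _ => (Fintype.card (S × A) : ℝ)⁻¹,
    fun _ => by positivity, by
      rw [Finset.sum_const, Finset.card_univ, nsmul_eq_mul, mul_inv_cancel₀ hc.ne']⟩
  refine ⟨ω, (det_featureMatrix_nonneg φ ω).lt_of_ne' fun h0 => ?_⟩
  obtain ⟨v, hv, hv0⟩ := Matrix.exists_mulVec_eq_zero_iff.2 h0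
  have hsum := dotProduct_featureMatrix_mulVec φ ω v v
  rw [hv0, dotProduct_zero, eq_comm,
    ← Fintype.sum_prod_type' (f := fun s' a' =>
    (ω : S × A → ℝ) (s', a') * (((φ s' a').ofLp ⬝ᵥ v) * ((φ s' a').ofLp ⬝ᵥ v))),
    Finset.sum_eq_zero_iff_of_nonneg fun x _ => ?_] at hsum
  swap
  · exact mul_nonneg (ω.2.1 x) (mul_self_nonneg _)
  have horth : ∀ x : S × A, inner ℝ (WithLp.toLp 2 v) (φ x.1 x.2) = 0 := fun x => by
    have h := hsum x (Finset.mem_univ x)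
    have hωx : (ω : S × A → ℝ) x = (Fintype.card (S × A) : ℝ)⁻¹ := rfl
    rw [hωx, mul_eq_zero, or_iff_right (inv_ne_zero hc.ne'), mul_self_eq_zero] at h
    rw [EuclideanSpace.inner_eq_star_dotProduct]
    simpa using h
  have hmem : WithLp.toLp 2 v ∈ (Submodule.span ℝ (Set.range fun x : S × A => φ x.1 x.2))ᗮ := by
    rw [Submodule.mem_orthogonal']
    intro w hw
    induction hw using Submodule.span_induction with
    | mem w hw => obtain ⟨x, rfl⟩ := hw; exact horth x
    | zero => exact inner_zero_right _
    | add w w' _ _ h h' => rw [inner_add_right, h, h', add_zero]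
    | smul c w _ h => rw [inner_smul_right, h, mul_zero]
  rw [hφ_span, Submodule.top_orthogonal_eq_bot, Submodule.mem_bot] at hmem
  exact hv (by simpa using hmem)

theorem continuous_det_featureMatrix :
    Continuous fun ω : stdSimplex ℝ (S × A) => (featureMatrix φ ω).det := by
  refine Continuous.matrix_det ?_
  unfold featureMatrix
  refine continuous_finsetSum _ fun s _ => continuous_finsetSum _ fun a _ => ?_
  exact ((continuous_apply (s, a)).comp continuous_subtype_val).smul continuous_const

/-- Matrix determinant lemma for a symmetric perturbation of rank one. -/
theorem det_add_smul_vecMulVec {Λ : Matrix (Fin d) (Fin d) ℝ} (hΛ : IsUnit Λ.det) (c : ℝ)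
    (v : Fin d → ℝ) :
    (Λ + c • Matrix.vecMulVec v v).det = Λ.det * (1 + c * (v ⬝ᵥ (Λ⁻¹).mulVec v)) := by
  rw [← Matrix.smul_vecMulVec, Matrix.vecMulVec_eq Unit,
    Matrix.det_add_replicateCol_mul_replicateRow (ι := Unit) hΛ, Matrix.det_unique (n := Unit)]
  congr 1
  rw [Matrix.add_apply, Matrix.one_apply_eq, Matrix.mul_assoc, Matrix.mul_apply]
  simp only [Matrix.replicateRow_apply, ← Matrix.replicateCol_mulVec, Matrix.replicateCol_apply,
    Matrix.mulVec_smul]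
  simp [dotProduct, Finset.mul_sum, mul_left_comm]

/-- Both sides equal `1` at `c = 0`, so their right derivatives there are ordered. This is the
first-order condition at a design of maximal determinant. -/
theorem le_of_one_add_mul_le_pow {g : ℝ} {d : ℕ}
    (h : ∀ c : ℝ, 0 < c → 1 + c * g ≤ (1 + c) ^ d) : g ≤ d := by
  have hd : HasDerivAt (fun c : ℝ => (1 + c) ^ d) (d : ℝ) 0 := by
    simpa using ((hasDerivAt_id (0 : ℝ)).const_add 1).fun_pow d
  refine ge_of_tendsto hd.tendsto_slope_zero_right ?_
  filter_upwards [self_mem_nhdsWithin] with c hc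
  have hc' : (0 : ℝ) < c := hc
  have h1 := h c hc'
  rw [smul_eq_mul, inv_mul_eq_div, le_div_iff₀ hc']
  simp only [zero_add, add_zero, one_pow]
  linarith

/-- The Kiefer–Wolfowitz theorem: the value of a G-optimal design is at most the dimension. -/
theorem exists_sigma_le [Nonempty S] [Nonempty A]
    (hφ_span : Submodule.span ℝ (Set.range fun x : S × A => φ x.1 x.2) = ⊤) :
    ∃ ω : stdSimplex ℝ (S × A), sigma φ ω ≤ d := by
  classical
  obtain ⟨ω₀, hω₀⟩ := exists_det_featureMatrix_pos φ hφ_span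
  obtain ⟨ω, -, hmax⟩ := isCompact_univ.exists_isMaxOn ⟨ω₀, Set.mem_univ _⟩
    (continuous_det_featureMatrix φ).continuousOn
  have hmax' : ∀ ω', (featureMatrix φ ω').det ≤ (featureMatrix φ ω).det :=
    fun ω' => hmax (Set.mem_univ ω')
  have hpos : 0 < (featureMatrix φ ω).det := hω₀.trans_le (hmax' ω₀)
  refine ⟨ω, ?_⟩
  rw [sigma, if_pos hpos.ne'.isUnit]
  refine iSup₂_le fun s a => ?_
  rw [ENNReal.ofReal_le_iff_le_toReal (ENNReal.natCast_ne_top d), ENNReal.toReal_natCast]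
  refine le_of_one_add_mul_le_pow fun c hc => ?_
  have hc1 : 0 < 1 + c := by linarith
  -- Moving mass `c / (1 + c)` to `(s, a)` makes the new matrix `(1 + c)⁻¹` times a rank-one update,
  -- so maximality of the determinant reads `1 + c * g ≤ (1 + c) ^ d` with `g = φᵀ Λ⁻¹ φ`.
  let ω' : stdSimplex ℝ (S × A) := ⟨(1 + c)⁻¹ • (ω : S × A → ℝ) + (c / (1 + c)) •
    Pi.single (s, a) 1, convex_stdSimplex ℝ _ ω.2 (single_mem_stdSimplex ℝ (s, a))
      (by positivity) (by positivity) (by field_simp)⟩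
  have hω' : featureMatrix φ ω' = (1 + c)⁻¹ • (featureMatrix φ ω +
      c • Matrix.vecMulVec (φ s a).ofLp (φ s a).ofLp) := by
    have hval : ∀ s' a', (ω' : S × A → ℝ) (s', a') = (1 + c)⁻¹ * ((ω : S × A → ℝ) (s', a') +
        c * (Pi.single (s, a) 1 : S × A → ℝ) (s', a')) := fun s' a' => by
      change (1 + c)⁻¹ * (ω : S × A → ℝ) (s', a') +
        c / (1 + c) * (Pi.single (s, a) 1 : S × A → ℝ) (s', a') = _
      ring
    have hsingle : ∑ s', ∑ a', (c * (Pi.single (s, a) 1 : S × A → ℝ) (s', a')) •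
        Matrix.vecMulVec (φ s' a').ofLp (φ s' a').ofLp =
        c • Matrix.vecMulVec (φ s a).ofLp (φ s a).ofLp := by
      rw [← Fintype.sum_prod_type' (f := fun s' a' => (c * (Pi.single (s, a) 1 : S × A → ℝ)
        (s', a')) • Matrix.vecMulVec (φ s' a').ofLp (φ s' a').ofLp)]
      rw [Finset.sum_eq_single (s, a) (fun x _ hx => by simp [Pi.single_eq_of_ne hx]) (by simp)]
      simp
    rw [← hsingle]
    simp only [featureMatrix, hval, mul_smul, add_smul, Finset.sum_add_distrib, Finset.smul_sum,
      smul_add]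
  have h := hmax' ω'
  rw [hω', Matrix.det_smul, det_add_smul_vecMulVec hpos.ne'.isUnit, Fintype.card_fin,
    mul_left_comm, mul_le_iff_le_one_right hpos, inv_pow, inv_mul_le_iff₀ (by positivity),
    mul_one] at h
  exact h

end Features

end LinMDP
end

/-! ### Information needed to separate `M` from an alternative. -/

noncomputable section

namespace LinMDP

namespace EpisodicLinearMDP

variable {S A : Type*} [Fintype S] [Fintype A] {d H : ℕ}
  {φ : S → A → EuclideanSpace ℝ (Fin d)} {ν : Measure ℝ}

/-- Linearity of the MDPs enters here: `y` depends on the step and on `W` but not on `(s, a)`, so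
errors at sampled pairs control errors at all pairs. -/
theorem bellman_error_eq_inner (M M' : EpisodicLinearMDP H φ ν) (h : Fin H) (W : S → ℝ) :
    ∃ y : EuclideanSpace ℝ (Fin d), ∀ s a, M'.r h s a - M.r h s a +
      ∑ s', ((M'.p h s a s').toReal - (M.p h s a s').toReal) * W s' = inner ℝ (φ s a) y := by
  refine ⟨M'.θ h - M.θ h + ∑ s', W s' • (M'.μ h s' - M.μ h s'), fun s a => ?_⟩
  simp only [inner_add_right, inner_sub_right, inner_sum, inner_smul_right, ← p_linear,
    ← r_linear, r, mul_comm (W _)]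

variable [MeasurableSpace S]

/-- Pinsker applied to the reward, of range `1`, and to `W` at the next state, of range `b`; each
divergence is at most their sum `KL`. -/
theorem abs_bellman_error_le [MeasurableSingletonClass S] (hν : ν (Set.Icc 0 1)ᶜ = 0)
    (M M' : EpisodicLinearMDP H φ ν) (h : Fin H) (s : S) (a : A) {W : S → ℝ} {b : ℝ} (hb : 0 ≤ b)
    (hW : ∀ s, W s ∈ Set.Icc 0 b) (hkl : M.KL M' h s a ≠ ∞) :
    |M'.r h s a - M.r h s a + ∑ s', ((M'.p h s a s').toReal - (M.p h s a s').toReal) * W s'| ≤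
      (b + 1) * √((M.KL M' h s a).toReal / 2) := by
  obtain ⟨hq, hp⟩ := ENNReal.add_ne_top.1 hkl
  have := M.q_prob h s a
  have := M'.q_prob h s a
  have h1 := abs_integral_sub_le_klDiv (f := fun x => x) aemeasurable_id
    (M'.ae_q_mem_Icc hν h s a) zero_le_one hq
  have h2 := abs_integral_sub_le_klDiv (f := W)
    (measurable_of_finite W).aemeasurable (.of_forall hW) hb hp
  rw [PMF.integral_eq_sum, PMF.integral_eq_sum, ← Finset.sum_sub_distrib] at h2
  simp only [smul_eq_mul, ← sub_mul] at h2
  have hq' : √((klDiv (M.q h s a) (M'.q h s a)).toReal / 2) ≤ √((M.KL M' h s a).toReal / 2) :=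
    Real.sqrt_le_sqrt (div_le_div_of_nonneg_right
      (ENNReal.toReal_mono hkl le_self_add) zero_le_two)
  have hp' : √((klDiv (M.p h s a).toMeasure (M'.p h s a).toMeasure).toReal / 2) ≤
      √((M.KL M' h s a).toReal / 2) :=
    Real.sqrt_le_sqrt (div_le_div_of_nonneg_right
      (ENNReal.toReal_mono hkl le_add_self) zero_le_two)
  calc _ ≤ _ := abs_add_le _ _
    _ ≤ _ := add_le_add h1 h2
    _ ≤ 1 * √((M.KL M' h s a).toReal / 2) + b * √((M.KL M' h s a).toReal / 2) := by gcongr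
    _ = _ := by ring

theorem exists_separation_of_mem_Alt {M M' : EpisodicLinearMDP H φ ν} {ε : ℝ} (hε : 0 ≤ ε)
    {πstar : Policy S A H} (hopt : M.IsOptimal πstar) (hM' : M' ∈ M.Alt ε) :
    ∃ (π : Policy S A H) (h : Fin H) (s : S),
      M.gap πstar ≤ ENNReal.ofReal (M.V πstar h s - M.V π h s) ∧
      ε < M'.V π h s - M'.V πstar h s := by
  have : Nonempty (Policy S A H) := ⟨πstar⟩
  have hmem : πstar ∈ M.epsOptimal ε := fun s => by
    rw [hopt.Vstar_eq]
    linarith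
  have hnmem : πstar ∉ M'.epsOptimal ε := fun hmem' => by
    have : πstar ∈ M.epsOptimal ε ∩ M'.epsOptimal ε := ⟨hmem, hmem'⟩
    rw [hM'.2] at this
    exact this
  obtain ⟨s, hs⟩ := not_forall.1 hnmem
  have hlt : M'.V πstar 0 s + ε < M'.Vstar 0 s := by linarith [not_le.1 hs]
  obtain ⟨π, hπ⟩ := exists_lt_of_lt_ciSup hlt
  obtain ⟨h, s', hne, hsep⟩ := M'.exists_ne_of_lt_V_sub πstar π hε (h := 0) (s := s)
    (by linarith)
  refine ⟨π, h, s', (iInf₂_le_of_le h s' (iInf₂_le (π h s') hne)).trans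
    (ENNReal.ofReal_le_ofReal ?_), hsep⟩
  rw [hopt.Vstar_eq]
  exact sub_le_sub_left (M.V_le_Qstar π h s') _

/-- Values of a policy in two linear MDPs differ by at most a multiple of the information that a
design gathers to tell them apart. -/
theorem abs_V_sub_le_sum_sqrt [MeasurableSingletonClass S] (hν : ν (Set.Icc 0 1)ᶜ = 0)
    (M M' : EpisodicLinearMDP H φ ν) {ω : Fin H → stdSimplex ℝ (S × A)}
    (hσ : ∀ h, sigma φ (ω h) ≠ ∞)
    (hkl : ∀ h s a, 0 < (ω h : S × A → ℝ) (s, a) → M.KL M' h s a ≠ ∞)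
    (π : Policy S A H) (h : Fin H) (s : S) :
    |M'.V π h s - M.V π h s| ≤ H * ∑ k, √((sigma φ (ω k)).toReal *
      ((∑ s, ∑ a, (ω k : S × A → ℝ) (s, a) * (M.KL M' k s a).toReal) / 2)) := by
  let F : Fin H → ℝ := fun k => √((sigma φ (ω k)).toReal *
      ((∑ s, ∑ a, (ω k : S × A → ℝ) (s, a) * (M.KL M' k s a).toReal) / 2))
  let g : ℕ → ℝ := fun k => if hk : k < H then H * F ⟨k, hk⟩ else 0
  have hg0 : ∀ k, 0 ≤ g k := fun k => by
    by_cases hk : k < H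
    · simp only [g, hk, dif_pos]
      exact mul_nonneg (Nat.cast_nonneg _) (Real.sqrt_nonneg _)
    · simp [g, hk]
  refine (M.abs_V_sub_le M' π (g := g) (fun k s a => ?_) (n := H - h) (by omega) s).trans ?_
  · have hgk : g k = H * F k := by simp [g]
    rw [hgk]
    obtain ⟨y, hy⟩ := M.bellman_error_eq_inner M' k (fun s' => M'.V π (k + 1) s')
    have herr : ∀ s a, (ω k : S × A → ℝ) (s, a) * inner ℝ (φ s a) y ^ 2 ≤
        (ω k : S × A → ℝ) (s, a) * (H ^ 2 * ((M.KL M' k s a).toReal / 2)) := fun s a => by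
      -- At zero weight the divergence may be infinite, and Pinsker is unavailable; the weight
      -- annihilates both sides.
      rcases ((ω k).2.1 (s, a)).eq_or_lt with h0 | h0
      · have h0' : (ω k : S × A → ℝ) (s, a) = 0 := h0.symm
        rw [h0', zero_mul, zero_mul]
      · refine mul_le_mul_of_nonneg_left ?_ h0.le
        -- After step `k` at most `H - (k + 1)` rewards remain; the current reward raises the total
        -- range to at most `H`.
        have hb := M.abs_bellman_error_le hν M' k s a (b := (H - (k + 1) : ℕ)) (Nat.cast_nonneg _)
          (fun s' => M'.V_mem_Icc hν π (h := k + 1) (n := H - (k + 1)) (by omega) s')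
          (hkl k s a h0)
        rw [hy] at hb
        have hH : (((H - (k + 1) : ℕ) : ℝ) + 1) ≤ H := by
          have : H - ((k : ℕ) + 1) + 1 ≤ H := by omega
          exact_mod_cast this
        have hb' := hb.trans (mul_le_mul_of_nonneg_right hH (Real.sqrt_nonneg _))
        calc inner ℝ (φ s a) y ^ 2 ≤ (H * √((M.KL M' k s a).toReal / 2)) ^ 2 :=
              sq_le_sq' (abs_le.1 hb').1 (abs_le.1 hb').2
          _ = _ := by rw [mul_pow, Real.sq_sqrt (by positivity)]
    have hK : 0 ≤ ∑ s, ∑ a, (ω k : S × A → ℝ) (s, a) * (M.KL M' k s a).toReal :=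
      Finset.sum_nonneg fun s _ => Finset.sum_nonneg fun a _ =>
        mul_nonneg ((ω k).2.1 _) ENNReal.toReal_nonneg
    rw [hy]
    refine abs_le_of_sq_le_sq ?_ (mul_nonneg (Nat.cast_nonneg _) (Real.sqrt_nonneg _))
    rw [mul_pow, Real.sq_sqrt (mul_nonneg ENNReal.toReal_nonneg (by positivity))]
    calc _ ≤ _ := sq_inner_le_sigma φ (ω k) (hσ k) s a y
      _ ≤ (sigma φ (ω k)).toReal * ∑ s, ∑ a, (ω k : S × A → ℝ) (s, a) *
          (H ^ 2 * ((M.KL M' k s a).toReal / 2)) :=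
        mul_le_mul_of_nonneg_left (Finset.sum_le_sum fun s _ => Finset.sum_le_sum fun a _ =>
          herr s a) ENNReal.toReal_nonneg
      _ = _ := by
        simp only [Finset.mul_sum, Finset.sum_div]
        exact Finset.sum_congr rfl fun _ _ => Finset.sum_congr rfl fun _ _ => by ring
  · calc _ ≤ ∑ k ∈ Finset.range H, g k :=
          Finset.sum_le_sum_of_subset_of_nonneg (fun k hk => by simp at hk ⊢; omega)
            fun k _ _ => hg0 k
      _ = _ := by
        rw [Finset.sum_range, Finset.mul_sum]
        exact Finset.sum_congr rfl fun k _ => by simp [g, F]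

/-- Lower bound on the information separating `M` from an alternative. -/
theorem sq_gap_add_le [MeasurableSingletonClass S] (hν : ν (Set.Icc 0 1)ᶜ = 0)
    {M M' : EpisodicLinearMDP H φ ν} {ε : ℝ} (hε : 0 ≤ ε) {πstar : Policy S A H}
    (hopt : M.IsOptimal πstar) (hM' : M' ∈ M.Alt ε) {ω : Fin H → stdSimplex ℝ (S × A)}
    (hσ : ∀ h, sigma φ (ω h) ≠ ∞)
    (hX : ∑ h, ∑ s, ∑ a, ENNReal.ofReal ((ω h : S × A → ℝ) (s, a)) * M.KL M' h s a ≠ ∞) :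
    ∃ D : ℝ, 0 < D ∧ M.gap πstar + ENNReal.ofReal ε ≤ ENNReal.ofReal D ∧
      D ^ 2 ≤ 2 * H ^ 2 * (∑ h, sigma φ (ω h)).toReal *
        (∑ h, ∑ s, ∑ a, ENNReal.ofReal ((ω h : S × A → ℝ) (s, a)) * M.KL M' h s a).toReal := by
  obtain ⟨π, h, s, hgap, hsep⟩ := exists_separation_of_mem_Alt hε hopt hM'
  have hterm : ∀ h s a, ENNReal.ofReal ((ω h : S × A → ℝ) (s, a)) * M.KL M' h s a ≠ ∞ := by
    simpa [ENNReal.sum_eq_top] using hX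
  have hkl : ∀ h s a, 0 < (ω h : S × A → ℝ) (s, a) → M.KL M' h s a ≠ ∞ := fun h s a hpos htop => by
    refine hterm h s a ?_
    rw [htop, ENNReal.mul_top (by simpa using hpos)]
  have hXreal : (∑ h, ∑ s, ∑ a, ENNReal.ofReal ((ω h : S × A → ℝ) (s, a)) * M.KL M' h s a).toReal =
      ∑ h, ∑ s, ∑ a, (ω h : S × A → ℝ) (s, a) * (M.KL M' h s a).toReal := by
    rw [ENNReal.toReal_sum fun h _ => ENNReal.sum_ne_top.2 fun s _ =>
      ENNReal.sum_ne_top.2 fun a _ => hterm h s a]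
    refine Finset.sum_congr rfl fun h _ => ?_
    rw [ENNReal.toReal_sum fun s _ => ENNReal.sum_ne_top.2 fun a _ => hterm h s a]
    refine Finset.sum_congr rfl fun s _ => ?_
    rw [ENNReal.toReal_sum fun a _ => hterm h s a]
    refine Finset.sum_congr rfl fun a _ => ?_
    have h0 : 0 ≤ (ω h : S × A → ℝ) (s, a) := (ω h).2.1 _
    rw [ENNReal.toReal_mul, ENNReal.toReal_ofReal h0]
  have hσreal : (∑ h, sigma φ (ω h)).toReal = ∑ h, (sigma φ (ω h)).toReal :=
    ENNReal.toReal_sum fun h _ => hσ h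
  set B := ∑ k, √((sigma φ (ω k)).toReal *
      ((∑ s, ∑ a, (ω k : S × A → ℝ) (s, a) * (M.KL M' k s a).toReal) / 2)) with hB
  have hB2 : B ^ 2 ≤ (∑ h, (sigma φ (ω h)).toReal) *
      ∑ h, (∑ s, ∑ a, (ω h : S × A → ℝ) (s, a) * (M.KL M' h s a).toReal) / 2 := by
    have hK : ∀ h, 0 ≤ (∑ s, ∑ a, (ω h : S × A → ℝ) (s, a) * (M.KL M' h s a).toReal) / 2 :=
      fun h => div_nonneg (Finset.sum_nonneg fun s _ => Finset.sum_nonneg fun a _ =>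
        mul_nonneg ((ω h).2.1 _) ENNReal.toReal_nonneg) zero_le_two
    exact Finset.sum_sq_le_sum_mul_sum_of_sq_le_mul _ (fun h _ => ENNReal.toReal_nonneg)
      (fun h _ => hK h) fun h _ => (Real.sq_sqrt (mul_nonneg ENNReal.toReal_nonneg (hK h))).le
  have e1 := (abs_le.1 (M.abs_V_sub_le_sum_sqrt hν M' hσ hkl π h s)).2
  have e2 := (abs_le.1 (M.abs_V_sub_le_sum_sqrt hν M' hσ hkl πstar h s)).1
  rw [← hB] at e1 e2
  have hnn : 0 ≤ M.V πstar h s - M.V π h s := sub_nonneg.2 (hopt h π s)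
  -- `D` is the loss in `M` plus the gain in `M'`. The strict gain keeps `D` positive even if the
  -- gap and `ε` both vanish.
  refine ⟨M.V πstar h s - M.V π h s + (M'.V π h s - M'.V πstar h s), by linarith, ?_, ?_⟩
  · rw [ENNReal.ofReal_add hnn (by linarith)]
    exact add_le_add hgap (ENNReal.ofReal_le_ofReal hsep.le)
  · rw [hXreal, hσreal]
    rw [← Finset.sum_div] at hB2
    -- Regrouped by policy, `D` is a sum of two changes of value between the models, each at most `H
    -- * B`.
    calc _ ≤ (2 * (H * B)) ^ 2 := pow_le_pow_left₀ (by linarith) (by linarith) 2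
      _ = 4 * H ^ 2 * B ^ 2 := by ring
      _ ≤ 4 * H ^ 2 * _ := mul_le_mul_of_nonneg_left hB2 (by positivity)
      _ = _ := by ring

theorem T_le [MeasurableSingletonClass S] (hν : ν (Set.Icc 0 1)ᶜ = 0)
    (M : EpisodicLinearMDP H φ ν) {ε : ℝ} (hε : 0 ≤ ε) {πstar : Policy S A H}
    (hopt : M.IsOptimal πstar) (ω : Fin H → stdSimplex ℝ (S × A)) :
    M.T ε ω ≤ 10 * (H : ℝ≥0∞) ^ 2 * (∑ h, sigma φ (ω h)) /
      (3 * (M.gap πstar + ENNReal.ofReal ε) ^ 2) := by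
  unfold T
  simp only [ENNReal.inv_iInf]
  -- The inverse of the infimum is a supremum over alternatives, which is `0` if there are none.
  refine iSup₂_le fun M' hM' => ?_
  set X := ∑ h, ∑ s, ∑ a, ENNReal.ofReal ((ω h : S × A → ℝ) (s, a)) * M.KL M' h s a with hXdef
  set E := M.gap πstar + ENNReal.ofReal ε with hE
  -- The existence of an alternative forces a suboptimal action, hence a finite gap.
  have hEtop : E ≠ ∞ := by
    obtain ⟨π, h, s, hgap, -⟩ := exists_separation_of_mem_Alt hε hopt hM'
    exact ENNReal.add_ne_top.2 ⟨ne_top_of_le_ne_top ENNReal.ofReal_ne_top hgap,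
      ENNReal.ofReal_ne_top⟩
  have hden : 3 * E ^ 2 ≠ ∞ := ENNReal.mul_ne_top (by simp) (ENNReal.pow_ne_top hEtop)
  by_cases hX : X = ∞
  · simp [hX]
  have hH : H ≠ 0 := by
    obtain ⟨-, h, -⟩ := exists_separation_of_mem_Alt hε hopt hM'
    exact (h.pos).ne'
  by_cases hσ : ∑ h, sigma φ (ω h) = ∞
  · have hnum : 10 * (H : ℝ≥0∞) ^ 2 * ∑ h, sigma φ (ω h) = ∞ := by
      rw [hσ, ENNReal.mul_top (by simp [hH])]
    rw [hnum, ENNReal.top_div_of_ne_top hden]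
    exact le_top
  obtain ⟨D, hD, hED, hle⟩ := sq_gap_add_le hν hε hopt hM'
    (fun h => ne_top_of_le_ne_top hσ (Finset.single_le_sum (f := fun h => sigma φ (ω h))
      (fun _ _ => zero_le) (Finset.mem_univ h))) hX
  have hle' : ENNReal.ofReal D ^ 2 ≤ 2 * (H : ℝ≥0∞) ^ 2 * (∑ h, sigma φ (ω h)) * X := by
    rw [← ENNReal.ofReal_pow hD.le]
    refine (ENNReal.ofReal_le_ofReal hle).trans_eq ?_
    rw [← hXdef, ENNReal.ofReal_mul (by positivity), ENNReal.ofReal_toReal hX,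
      ENNReal.ofReal_mul (by positivity), ENNReal.ofReal_toReal hσ,
      ENNReal.ofReal_mul (by positivity), ENNReal.ofReal_pow (by positivity)]
    simp
  have hX0 : X ≠ 0 := fun h0 => by
    rw [h0, mul_zero, le_zero_iff] at hle'
    simp only [ne_eq, OfNat.ofNat_ne_zero, not_false_eq_true, pow_eq_zero_iff,
      ENNReal.ofReal_eq_zero] at hle'
    linarith
  have hnum0 : 10 * (H : ℝ≥0∞) ^ 2 * (∑ h, sigma φ (ω h)) ≠ 0 := by
    refine mul_ne_zero (by simp [hH]) fun h0 => ?_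
    rw [h0, mul_zero, zero_mul, le_zero_iff] at hle'
    simp only [ne_eq, OfNat.ofNat_ne_zero, not_false_eq_true, pow_eq_zero_iff,
      ENNReal.ofReal_eq_zero] at hle'
    linarith
  rw [ENNReal.le_div_iff_mul_le (.inr hnum0) (.inl hden), ENNReal.inv_mul_le_iff hX0 hX]
  calc 3 * E ^ 2 ≤ 3 * ENNReal.ofReal D ^ 2 := by gcongr
    _ ≤ 3 * (2 * (H : ℝ≥0∞) ^ 2 * (∑ h, sigma φ (ω h)) * X) := by gcongr
    _ = 6 * (X * ((H : ℝ≥0∞) ^ 2 * (∑ h, sigma φ (ω h)))) := by ring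
    -- The argument yields the constant `2 = 6 / 3`, within the claimed `10 / 3`.
    _ ≤ 10 * (X * ((H : ℝ≥0∞) ^ 2 * (∑ h, sigma φ (ω h)))) := by gcongr; norm_num
    _ = _ := by ring

end EpisodicLinearMDP

end LinMDP

end

theorem mainTheorem7 {S A : Type*} [Fintype S] [Fintype A] [Nonempty S] [Nonempty A]
    [MeasurableSpace S] [MeasurableSingletonClass S] {d H : ℕ}
    (φ : S → A → EuclideanSpace ℝ (Fin d))
    (hφ_norm : ∀ s a, ‖φ s a‖ ≤ 1)
    (hφ_span : Submodule.span ℝ (Set.range fun x : S × A => φ x.1 x.2) = ⊤)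
    (ν : Measure ℝ) (hν : ν (Set.Icc 0 1)ᶜ = 0)
    (ε : ℝ) (hε : 0 ≤ ε)
    (M : LinMDP.EpisodicLinearMDP H φ ν)
    (πstar : LinMDP.Policy S A H) (hopt : M.IsOptimal πstar)
    (huniq : ∀ π, M.IsOptimal π → π = πstar) :
    (∀ ω : Fin H → stdSimplex ℝ (S × A),
      M.T ε ω ≤ 10 * (H : ℝ≥0∞) ^ 2 * (∑ h, LinMDP.sigma φ (ω h)) /
        (3 * (M.gap πstar + ENNReal.ofReal ε) ^ 2)) ∧
    M.Tstar ε ≤ 10 * (H : ℝ≥0∞) ^ 3 * (d : ℝ≥0∞) /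
        (3 * (M.gap πstar + ENNReal.ofReal ε) ^ 2) := by
  refine ⟨M.T_le hν hε hopt, ?_⟩
  obtain ⟨ω, hω⟩ := LinMDP.exists_sigma_le φ hφ_span
  have hle : M.Tstar ε ≤ M.T ε fun _ => ω :=
    ENNReal.inv_le_iff_inv_le.1 (le_iSup (fun ω : Fin H → stdSimplex ℝ (S × A) => (M.T ε ω)⁻¹) _)
  refine hle.trans ((M.T_le hν hε hopt fun _ => ω).trans (ENNReal.div_le_div_right ?_ _))
  rw [Finset.sum_const, Finset.card_univ, Fintype.card_fin, nsmul_eq_mul]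
  calc 10 * (H : ℝ≥0∞) ^ 2 * (H * LinMDP.sigma φ ω) ≤ 10 * (H : ℝ≥0∞) ^ 2 * (H * d) := by gcongr
    _ = _ := by ring
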